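/- Let $n,p\in\mathbb{N}$ and let $f:\mathbb{R}^n\times\mathbb{R}^p\times\mathbb{Z}_{\ge0}\to\mathbb{R}^n$ be such that for every $t\in\mathbb{Z}_{\ge0}$ there is $L_t\ge 0$ with $\|f(x,u,t)-f(y,u,t)\|\le L_t\|x-y\|$ for all $x,y\in\mathbb{R}^n$ and $u\in\mathbb{R}^p$, where $\|\cdot\|$ is the Euclidean norm. Let $w_0,w_1,\dots$ be independent random vectors in $\mathbb{R}^n$ such that, for every $t$ and some finite $\sigma_t\ge0$, $w_t$ is sub-Gaussian with variance proxy $\sigma_t^2$, that is, $\mathbb{E}(w_t)=0$ and $\mathbb{E}\big(e^{\lambda\langle \ell,w_t\rangle}\big)\le e^{\lambda^2\sigma_t^2/2}$ for all $\lambda\in\mathbb{R}$ and all unit vectors $\ell\in\mathbb{R}^n$. Let $x_0\in\mathbb{R}^n$ and let $(u_t)_{t\ge0}$ be a (deterministic) input sequence in $\mathbb{R}^p$. Let $X_t$ and $x_t$ be the trajectories of $$X_{t+1}=f(X_t,u_t,t)+w_t,\qquad x_{t+1}=f(x_t,u_t,t)$$ with the same initial state $X_0=x_0$ and the same inputs.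 Then for all $t\ge0$ and all $\delta,\varepsilon\in(0,1)$, with probability at least $1-\delta$, $$\|X_t-x_t\|\le\sqrt{\Psi_t\big(\varepsilon_1 n+\varepsilon_2\log(1/\delta)\big)},$$ where $$\Psi_t=\psi_{t-1}\sum_{k=0}^{t-1}\sigma_k^2\psi_k^{-1},\quad \psi_t=\prod_{k=0}^{t}L_k^2,\quad \varepsilon_1=\frac{2\log(1+2/\varepsilon)}{(1-\varepsilon)^2},\quad \varepsilon_2=\frac{2}{(1-\varepsilon)^2}.$$ Here the quotient $\psi_{t-1}\psi_k^{-1}$ is read as $\prod_{j=k+1}^{t-1}L_j^2$, so that $\Psi_t=\sum_{k=0}^{t-1}\sigma_k^2\prod_{j=k+1}^{t-1}L_j^2$ (with $\Psi_0=0$); this is also meaningful if some $L_j=0$. -/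

import Mathlib

open MeasureTheory ProbabilityTheory

noncomputable section

/-- A random vector `X` in `ℝⁿ` is sub-Gaussian with variance proxy `v` (written `subG(v)`):
it has mean zero and `E exp (c ⟪l, X⟫) ≤ exp (c² v / 2)` for every real `c` and unit vector `l`.
The integrability fields say that the expectations involved really exist and are finite. -/
structure IsSubG {n : ℕ} {Ω : Type*} [MeasurableSpace Ω]
    (X : Ω → EuclideanSpace ℝ (Fin n)) (v : ℝ) (μ : Measure Ω) : Prop where
  integrable : Integrable X μ
  mean_zero : ∫ ω, X ω ∂μ = 0
  integrable_exp : ∀ (c : ℝ) (l : EuclideanSpace ℝ (Fin n)), ‖l‖ = 1 →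
    Integrable (fun ω => Real.exp (c * inner ℝ l (X ω))) μ
  mgf_le : ∀ (c : ℝ) (l : EuclideanSpace ℝ (Fin n)), ‖l‖ = 1 →
    ∫ ω, Real.exp (c * inner ℝ l (X ω)) ∂μ ≤ Real.exp (c ^ 2 * v / 2)

/-- `ψ_t = ∏_{k=0}^{t} L_k²`. -/
def psi (L : ℕ → ℝ) (t : ℕ) : ℝ := ∏ k ∈ Finset.range (t + 1), L k ^ 2

/-- `Ψ_t = ψ_{t-1} ∑_{k=0}^{t-1} σ_k² ψ_k⁻¹`, with the quotient `ψ_{t-1} ψ_k⁻¹` written without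
division as `∏_{j=k+1}^{t-1} L_j²`, so that the formula also makes sense when some `L_j = 0`.
See `Psi_eq` for the agreement of the two expressions. -/
def Psi (L σ : ℕ → ℝ) (t : ℕ) : ℝ :=
  ∑ k ∈ Finset.range t, σ k ^ 2 * ∏ j ∈ Finset.Ico (k + 1) t, L j ^ 2

/-- If no `L_k` with `k < t` vanishes, then `Ψ_t = ψ_{t-1} ∑_{k=0}^{t-1} σ_k² ψ_k⁻¹` literally. -/
theorem Psi_eq (L σ : ℕ → ℝ) (t : ℕ) (hL : ∀ k < t, L k ≠ 0) :
    Psi L σ t = psi L (t - 1) * ∑ k ∈ Finset.range t, σ k ^ 2 * (psi L k)⁻¹ := by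
  unfold Psi
  rw [Finset.mul_sum]
  refine Finset.sum_congr rfl fun k hk => ?_
  have hkt : k < t := Finset.mem_range.1 hk
  have h1 : t - 1 + 1 = t := by omega
  have hne : psi L k ≠ 0 := by
    refine Finset.prod_ne_zero_iff.2 fun j hj => pow_ne_zero 2 (hL j ?_)
    have := Finset.mem_range.1 hj
    omega
  have h2 : psi L (t - 1) = psi L k * ∏ j ∈ Finset.Ico (k + 1) t, L j ^ 2 := by
    unfold psi
    rw [h1, Finset.prod_range_mul_prod_Ico _ hkt]
  rw [h2]
  field_simp

/-- `ε₁ = 2 log (1 + 2/ε) / (1 - ε)²`. -/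
def eps1 (ε : ℝ) : ℝ := 2 * Real.log (1 + 2 / ε) / (1 - ε) ^ 2

/-- `ε₂ = 2 / (1 - ε)²`. -/
def eps2 (ε : ℝ) : ℝ := 2 / (1 - ε) ^ 2

end

/-! ### Averaging the moment generating function over the unit ball. -/

section BallMGF

variable {E : Type*} [NormedAddCommGroup E] [InnerProductSpace ℝ E] [FiniteDimensional ℝ E]
  [MeasurableSpace E] [BorelSpace E]

/-! Instead of a union bound over a net of directions, exponential moments are averaged over the
unit ball: Φ(v) = ∫ exp ⟪l, v⟫ dl, which is `ballMGF`. Φ depends only on ‖v‖ and is monotone in it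
(`ballMGF_mono`), so a Lipschitz step replaces s by s * L t; independent noise costs a factor
exp(s²σ_t²/2) (`lintegral_ballMGF_add_le`). Iterating, `lintegral_ballMGF_deviation_le` bounds E
Φ(s(X_t - x_t)) by exp(s²Ψ_t/2) times the volume of the ball. Conversely Φ(v) controls exp((1-ε)‖v‖)
up to (ε/2)^n (`le_ballMGF`), which bounds the exponential moments of the norm; Markov's inequality
with optimal s finishes. -/

/-- The moment generating function `v ↦ ∫ exp ⟪l, v⟫ dl` of Lebesgue measure on the unit ball. -/
noncomputable def ballMGF (v : E) : ENNReal :=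
  ∫⁻ l in Metric.closedBall (0 : E) 1, ENNReal.ofReal (Real.exp (inner ℝ l v))

theorem ballMGF_zero : ballMGF (0 : E) = volume (Metric.closedBall (0 : E) 1) := by
  simp [ballMGF]

theorem ballMGF_map (T : E ≃ₗᵢ[ℝ] E) (v : E) : ballMGF (T v) = ballMGF v := by
  unfold ballMGF
  have hT : MeasurePreserving T (volume : Measure E) volume := T.measurePreserving
  rw [← hT.setLIntegral_comp_preimage_emb T.toHomeomorph.measurableEmbedding]
  simp

/-- The reflection exchanging two vectors of equal norm preserves both the ball and Lebesgue
measure. -/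
theorem ballMGF_eq_of_norm_eq {v w : E} (h : ‖v‖ = ‖w‖) : ballMGF v = ballMGF w := by
  rw [← Submodule.reflection_sub h]
  exact (ballMGF_map _ v).symm

/-- Averages the integrand over ±v. Unlike exp, cosh increases with the absolute value of its
argument, so monotonicity can be checked pointwise. -/
theorem ballMGF_eq_lintegral_cosh (v : E) :
    ballMGF v = ∫⁻ l in Metric.closedBall (0 : E) 1,
      ENNReal.ofReal (Real.cosh (inner ℝ l v)) := by
  have h : ballMGF v + ballMGF v = 2 * ∫⁻ l in Metric.closedBall (0 : E) 1,
      ENNReal.ofReal (Real.cosh (inner ℝ l v)) := by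
    nth_rewrite 2 [← ballMGF_eq_of_norm_eq (norm_neg v)]
    unfold ballMGF
    rw [← lintegral_add_left (by fun_prop), ← lintegral_const_mul _ (by fun_prop)]
    refine lintegral_congr fun l => ?_
    rw [← ENNReal.ofReal_add (Real.exp_nonneg _) (Real.exp_nonneg _), inner_neg_right,
      Real.cosh_eq, ← ENNReal.ofReal_ofNat, ← ENNReal.ofReal_mul (by norm_num)]
    congr 1
    ring
  rw [← two_mul] at h
  exact (ENNReal.mul_right_inj (by norm_num) (by norm_num)).1 h

theorem ballMGF_mono {v w : E} (h : ‖v‖ ≤ ‖w‖) : ballMGF v ≤ ballMGF w := by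
  -- By radial symmetry v may be replaced by a multiple of w, which makes the two cosh integrands
  -- comparable for each l.
  obtain ⟨c, hc, hcw⟩ : ∃ c : ℝ, |c| ≤ 1 ∧ ‖v‖ = ‖c • w‖ := by
    rcases eq_or_ne w 0 with rfl | hw
    · exact ⟨0, by simp, by simpa using h⟩
    · have hw' : 0 < ‖w‖ := norm_pos_iff.2 hw
      refine ⟨‖v‖ / ‖w‖, ?_, ?_⟩
      · rw [abs_of_nonneg (by positivity)]
        exact (div_le_one hw').2 h
      · rw [norm_smul, Real.norm_of_nonneg (by positivity)]
        field_simp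
  rw [ballMGF_eq_of_norm_eq hcw, ballMGF_eq_lintegral_cosh, ballMGF_eq_lintegral_cosh]
  refine lintegral_mono fun l => ENNReal.ofReal_le_ofReal (Real.cosh_le_cosh.2 ?_)
  rw [inner_smul_right, abs_mul]
  exact mul_le_of_le_one_left (abs_nonneg _) hc

/-- Only directions l close to v matter: the ball of radius ε/2 around (1 - ε/2)e, with e = v/‖v‖,
lies in the unit ball, and there ⟪l, v⟫ ≥ (1 - ε/2)‖v‖ - (ε/2)‖v‖. -/
theorem le_ballMGF (v : E) {ε : ℝ} (hε₀ : 0 ≤ ε) (hε₁ : ε ≤ 1) :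
    ENNReal.ofReal ((ε / 2) ^ Module.finrank ℝ E) * volume (Metric.closedBall (0 : E) 1) *
      ENNReal.ofReal (Real.exp ((1 - ε) * ‖v‖)) ≤ ballMGF v := by
  set e : E := ‖v‖⁻¹ • v with he
  have he1 : ‖e‖ ≤ 1 := by
    rw [he, norm_smul, norm_inv, norm_norm]
    exact inv_mul_le_one
  have hev : inner ℝ e v = ‖v‖ := by
    rw [he, real_inner_smul_left, real_inner_self_eq_norm_sq]
    rcases eq_or_ne ‖v‖ 0 with h | h
    · simp [h]
    · field_simp
  have hsub : Metric.closedBall ((1 - ε / 2) • e) (ε / 2) ⊆ Metric.closedBall (0 : E) 1 := by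
    refine Metric.closedBall_subset_closedBall' ?_
    rw [dist_zero_right, norm_smul, Real.norm_of_nonneg (by linarith)]
    nlinarith
  have hle : ∀ l ∈ Metric.closedBall ((1 - ε / 2) • e) (ε / 2),
      (1 - ε) * ‖v‖ ≤ inner ℝ l v := by
    intro l hl
    rw [Metric.mem_closedBall, dist_eq_norm] at hl
    have h1 : inner ℝ l v = (1 - ε / 2) * ‖v‖ + inner ℝ (l - (1 - ε / 2) • e) v := by
      rw [inner_sub_left, real_inner_smul_left, hev]
      ring
    have h2 := (abs_le.1 (abs_real_inner_le_norm (l - (1 - ε / 2) • e) v)).1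
    have h3 := mul_le_mul_of_nonneg_right hl (norm_nonneg v)
    rw [h1]
    linarith
  rw [← Measure.addHaar_closedBall' volume ((1 - ε / 2) • e) (by linarith : 0 ≤ ε / 2), mul_comm,
    ← setLIntegral_const]
  refine le_trans (setLIntegral_mono (by fun_prop) fun l hl => ?_) (lintegral_mono_set hsub)
  exact ENNReal.ofReal_le_ofReal (Real.exp_le_exp.2 (hle l hl))

/-- Adding an independent vector whose exponential moments `E exp ⟪l, W⟫` are at most `C` for
`‖l‖ ≤ 1` increases the expectation of `ballMGF` at most by the factor `C`. -/
theorem lintegral_ballMGF_add_le {Ω : Type*} [MeasurableSpace Ω] {μ : Measure Ω} [SFinite μ]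
    {V W : Ω → E} (hV : Measurable V) (hW : Measurable W) (hVW : IndepFun V W μ)
    {C : ENNReal}
    (hC : ∀ l : E, ‖l‖ ≤ 1 → ∫⁻ ω, ENNReal.ofReal (Real.exp (inner ℝ l (W ω))) ∂μ ≤ C) :
    ∫⁻ ω, ballMGF (V ω + W ω) ∂μ ≤ C * ∫⁻ ω, ballMGF (V ω) ∂μ := by
  -- Tonelli reduces the claim to a fixed l, where the exponential of the sum factors by
  -- independence.
  have hswap : ∀ Z : Ω → E, Measurable Z → ∫⁻ ω, ballMGF (Z ω) ∂μ =
      ∫⁻ l in Metric.closedBall (0 : E) 1, ∫⁻ ω, ENNReal.ofReal (Real.exp (inner ℝ l (Z ω))) ∂μ :=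
    fun Z hZ => lintegral_lintegral_swap (by fun_prop)
  rw [hswap (fun ω => V ω + W ω) (hV.add hW), hswap V hV, ← lintegral_const_mul _ (Measurable.lintegral_prod_right' (f := fun z : E × Ω =>
      ENNReal.ofReal (Real.exp (inner ℝ z.1 (V z.2)))) (by fun_prop))]
  refine setLIntegral_mono' Metric.isClosed_closedBall.measurableSet fun l hl => ?_
  have hg : Measurable fun y : E => ENNReal.ofReal (Real.exp (inner ℝ l y)) := by fun_prop
  have hmul := lintegral_mul_eq_lintegral_mul_lintegral_of_indepFun (hg.comp hV) (hg.comp hW)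
    (hVW.comp hg hg)
  have hexp : ∀ ω, ENNReal.ofReal (Real.exp (inner ℝ l (V ω + W ω))) =
      (((fun y : E => ENNReal.ofReal (Real.exp (inner ℝ l y))) ∘ V) *
        ((fun y : E => ENNReal.ofReal (Real.exp (inner ℝ l y))) ∘ W)) ω := by
    intro ω
    simp only [Pi.mul_apply, Function.comp_apply]
    rw [← ENNReal.ofReal_mul (Real.exp_nonneg _), ← Real.exp_add, inner_add_right]
  rw [lintegral_congr hexp, hmul, mul_comm]
  exact mul_le_mul' (hC l (by simpa using hl)) le_rfl

end BallMGF

/-! ### Exponential moments of the noise and the recursion for `Psi`. -/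

theorem IsSubG.lintegral_exp_inner_le {n : ℕ} {Ω : Type*} [MeasurableSpace Ω]
    {μ : Measure Ω} [IsProbabilityMeasure μ] {W : Ω → EuclideanSpace ℝ (Fin n)} {v : ℝ}
    (h : IsSubG W v μ) (hv : 0 ≤ v) {l : EuclideanSpace ℝ (Fin n)} (hl : ‖l‖ ≤ 1) (s : ℝ) :
    ∫⁻ ω, ENNReal.ofReal (Real.exp (inner ℝ l (s • W ω))) ∂μ ≤
      ENNReal.ofReal (Real.exp (s ^ 2 * v / 2)) := by
  rcases eq_or_ne l 0 with rfl | hl0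
  · simp only [inner_zero_left, Real.exp_zero, ENNReal.ofReal_one, lintegral_const,
      measure_univ, mul_one]
    rw [← ENNReal.ofReal_one]
    exact ENNReal.ofReal_le_ofReal (Real.one_le_exp (by positivity))
  · have hpos : 0 < ‖l‖ := norm_pos_iff.2 hl0
    have hunit : ‖‖l‖⁻¹ • l‖ = 1 := norm_smul_inv_norm hl0
    -- The length of l is absorbed into the scalar, as `IsSubG` speaks of unit vectors only.
    have heq : ∀ ω, inner ℝ l (s • W ω) = (s * ‖l‖) * inner ℝ (‖l‖⁻¹ • l) (W ω) := by
      intro ω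
      rw [inner_smul_right, real_inner_smul_left]
      field_simp
    simp_rw [heq]
    rw [← ofReal_integral_eq_lintegral_ofReal (h.integrable_exp _ _ hunit)
      (ae_of_all _ fun ω => Real.exp_nonneg _)]
    refine ENNReal.ofReal_le_ofReal ((h.mgf_le _ _ hunit).trans (Real.exp_le_exp.2 ?_))
    have hsq : ‖l‖ ^ 2 ≤ 1 := pow_le_one₀ hpos.le hl
    have := mul_le_mul_of_nonneg_left hsq (mul_nonneg (sq_nonneg s) hv)
    rw [mul_pow]
    linarith

theorem Psi_succ (L σ : ℕ → ℝ) (t : ℕ) :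
    Psi L σ (t + 1) = L t ^ 2 * Psi L σ t + σ t ^ 2 := by
  unfold Psi
  rw [Finset.sum_range_succ, Finset.Ico_self, Finset.prod_empty, mul_one, Finset.mul_sum]
  congr 1
  refine Finset.sum_congr rfl fun k hk => ?_
  rw [Finset.prod_Ico_succ_top (by have := Finset.mem_range.1 hk; omega)]
  ring

theorem Psi_nonneg (L σ : ℕ → ℝ) (t : ℕ) : 0 ≤ Psi L σ t :=
  Finset.sum_nonneg fun _ _ => mul_nonneg (sq_nonneg _) (Finset.prod_nonneg fun _ _ => sq_nonneg _)

/-! ### Independence of the state and the current noise. -/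

/-- The state of a recursion driven by noise is a measurable function of the past noise. -/
theorem exists_measurable_eq_past {Ω S A : Type*} [MeasurableSpace S] [MeasurableSpace A]
    {F : ℕ → S → A → S} (hF : ∀ t, Measurable fun z : S × A => F t z.1 z.2)
    {w : ℕ → Ω → A} {X : ℕ → Ω → S} {x₀ : S}
    (hX_zero : ∀ ω, X 0 ω = x₀) (hX_succ : ∀ t ω, X (t + 1) ω = F t (X t ω) (w t ω)) (t : ℕ) :
    ∃ g : (Finset.range t → A) → S, Measurable g ∧ ∀ ω, X t ω = g fun i => w i ω := by
  induction t with
  | zero => exact ⟨fun _ => x₀, measurable_const, hX_zero⟩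
  | succ t ih =>
    obtain ⟨g, hg, hgX⟩ := ih
    refine ⟨fun a => F t (g fun i => a ⟨i, Finset.range_subset_range.2 t.le_succ i.2⟩)
      (a ⟨t, Finset.self_mem_range_succ t⟩), ?_, fun ω => ?_⟩
    · exact (hF t).comp ((hg.comp (measurable_pi_lambda _ fun i => measurable_pi_apply _)).prodMk
        (measurable_pi_apply _))
    · rw [hX_succ, hgX]

theorem indepFun_state_noise {Ω S A : Type*} [MeasurableSpace Ω] [MeasurableSpace S]
    [MeasurableSpace A] {μ : Measure Ω} {F : ℕ → S → A → S}
    (hF : ∀ t, Measurable fun z : S × A => F t z.1 z.2)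
    {w : ℕ → Ω → A} (hw_meas : ∀ t, Measurable (w t)) (hw_indep : iIndepFun w μ)
    {X : ℕ → Ω → S} {x₀ : S}
    (hX_zero : ∀ ω, X 0 ω = x₀) (hX_succ : ∀ t ω, X (t + 1) ω = F t (X t ω) (w t ω)) (t : ℕ) :
    IndepFun (X t) (w t) μ := by
  obtain ⟨g, hg, hgX⟩ := exists_measurable_eq_past hF hX_zero hX_succ t
  have h := hw_indep.indepFun_finset (Finset.range t) {t} (by simp) hw_meas
  have h' := h.comp hg (measurable_pi_apply (⟨t, Finset.mem_singleton_self t⟩ : ({t} : Finset ℕ)))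
  rw [show X t = _ from funext hgX]
  exact h'

/-! ### The tail bound. -/

/-- Markov's inequality for a random variable whose exponential moments satisfy a sub-Gaussian
bound up to a constant factor. -/
theorem measure_lt_le_of_lintegral_exp_le {Ω : Type*} [MeasurableSpace Ω] {μ : Measure Ω}
    {Y : Ω → ℝ} (hY : Measurable Y) {K P : ℝ} (hK : 0 < K) (hP : 0 ≤ P)
    (h : ∀ s, 0 ≤ s → ∫⁻ ω, ENNReal.ofReal (Real.exp (s * Y ω)) ∂μ ≤
      ENNReal.ofReal (K * Real.exp (s ^ 2 * P / 2)))
    {δ : ℝ} (hδ : 0 < δ) (hδK : δ ≤ K) :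
    μ {ω | √(2 * P * Real.log (K / δ)) < Y ω} ≤ ENNReal.ofReal δ := by
  have markov : ∀ r s : ℝ, 0 ≤ s →
      μ {ω | r ≤ Y ω} ≤ ENNReal.ofReal (K * Real.exp (s ^ 2 * P / 2 - s * r)) := by
    intro r s hs
    have h1 : {ω | r ≤ Y ω} ⊆ {ω | ENNReal.ofReal (Real.exp (s * r)) ≤
        ENNReal.ofReal (Real.exp (s * Y ω))} := fun ω hω =>
      ENNReal.ofReal_le_ofReal (Real.exp_le_exp.2 (mul_le_mul_of_nonneg_left hω hs))
    refine (measure_mono h1).trans ((meas_ge_le_lintegral_div (by fun_prop)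
      (ENNReal.ofReal_pos.2 (Real.exp_pos _)).ne' ENNReal.ofReal_ne_top).trans ?_)
    refine (ENNReal.div_le_div_right (h s hs) _).trans ?_
    rw [← ENNReal.ofReal_div_of_pos (Real.exp_pos _), mul_div_assoc, ← Real.exp_sub]
  have hlog : 0 ≤ Real.log (K / δ) := Real.log_nonneg ((one_le_div hδ).2 hδK)
  -- For P = 0 the optimal s = r / P is unavailable; letting s → ∞ shows Y ≤ 0 almost surely.
  rcases hP.eq_or_lt with rfl | hP
  · have hpos : ∀ k : ℕ, μ {ω | ((k : ℝ) + 1)⁻¹ ≤ Y ω} = 0 := by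
      intro k
      have hlim : Filter.Tendsto (fun s : ℝ => ENNReal.ofReal
          (K * Real.exp (s ^ 2 * 0 / 2 - s * ((k : ℝ) + 1)⁻¹))) Filter.atTop
          (nhds (ENNReal.ofReal (K * 0))) := by
        refine ENNReal.tendsto_ofReal (Filter.Tendsto.const_mul _ (Real.tendsto_exp_atBot.comp ?_))
        simp only [mul_zero, zero_div, zero_sub]
        exact Filter.tendsto_neg_atTop_atBot.comp
          (Filter.tendsto_id.atTop_mul_const (by positivity))
      have hle := ge_of_tendsto hlim ((Filter.eventually_ge_atTop 0).mono fun s hs =>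
        markov ((k : ℝ) + 1)⁻¹ s hs)
      simpa using hle
    have hsub : {ω | √(2 * 0 * Real.log (K / δ)) < Y ω} ⊆
        ⋃ k : ℕ, {ω | ((k : ℝ) + 1)⁻¹ ≤ Y ω} := by
      intro ω hω
      have hω' : 0 < Y ω := by simpa using hω
      obtain ⟨k, hk⟩ := exists_nat_one_div_lt hω'
      exact Set.mem_iUnion.2 ⟨k, by simpa using hk.le⟩
    exact ((measure_mono hsub).trans (measure_iUnion_null hpos).le).trans zero_le
  · set r := √(2 * P * Real.log (K / δ)) with hr
    have hr2 : r ^ 2 = 2 * P * Real.log (K / δ) := Real.sq_sqrt (by positivity)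
    refine (measure_mono fun ω (hω : r < Y ω) => hω.le).trans
      ((markov r (r / P) (by positivity)).trans (ENNReal.ofReal_le_ofReal (le_of_eq ?_)))
    have he : (r / P) ^ 2 * P / 2 - r / P * r = -Real.log (K / δ) := by
      field_simp
      rw [hr2]
      ring
    rw [he, Real.exp_neg, Real.exp_log (by positivity)]
    field_simp

/-! ### Propagation along the trajectory and conclusion. -/

/-- The averaged moment generating function of the deviation of a noisy trajectory from the
noiseless one. -/
theorem lintegral_ballMGF_deviation_le {n : ℕ} {Ω : Type*} [MeasurableSpace Ω] {μ : Measure Ω}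
    [IsProbabilityMeasure μ]
    {F : ℕ → EuclideanSpace ℝ (Fin n) → EuclideanSpace ℝ (Fin n)} {L : ℕ → ℝ}
    (hF : ∀ t x y, ‖F t x - F t y‖ ≤ L t * ‖x - y‖) {σ : ℕ → ℝ}
    {w : ℕ → Ω → EuclideanSpace ℝ (Fin n)} (hw_meas : ∀ t, Measurable (w t))
    (hw_subG : ∀ t, IsSubG (w t) (σ t ^ 2) μ)
    {X : ℕ → Ω → EuclideanSpace ℝ (Fin n)} {x : ℕ → EuclideanSpace ℝ (Fin n)}
    (hF_meas : ∀ t, Measurable (F t)) (hX_meas : ∀ t, Measurable (X t))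
    (hXw : ∀ t, IndepFun (X t) (w t) μ)
    (hX_zero : ∀ ω, X 0 ω = x 0) (hX_succ : ∀ t ω, X (t + 1) ω = F t (X t ω) + w t ω)
    (hx_succ : ∀ t, x (t + 1) = F t (x t)) (t : ℕ) (s : ℝ) :
    ∫⁻ ω, ballMGF (s • (X t ω - x t)) ∂μ ≤ ENNReal.ofReal (Real.exp (s ^ 2 * Psi L σ t / 2)) *
      volume (Metric.closedBall (0 : EuclideanSpace ℝ (Fin n)) 1) := by
  -- The induction hypothesis is used at s * L t, hence s must vary.
  induction t generalizing s with
  | zero => simp [hX_zero, ballMGF_zero, Psi]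
  | succ t ih =>
    have hφ : Measurable fun y => s • (F t y - F t (x t)) :=
      ((hF_meas t).sub_const _).const_smul s
    have hstep := lintegral_ballMGF_add_le (μ := μ) (hφ.comp (hX_meas t))
      ((hw_meas t).const_smul s) ((hXw t).comp hφ (measurable_const_smul s))
      fun l hl => (hw_subG t).lintegral_exp_inner_le (sq_nonneg _) hl s
    have hcontr : ∀ ω, ballMGF (s • (F t (X t ω) - F t (x t))) ≤
        ballMGF ((s * L t) • (X t ω - x t)) := by
      intro ω
      refine ballMGF_mono ?_
      rw [norm_smul, norm_smul, norm_mul, mul_assoc]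
      gcongr
      exact (hF t _ _).trans (mul_le_mul_of_nonneg_right (le_abs_self _) (norm_nonneg _))
    calc ∫⁻ ω, ballMGF (s • (X (t + 1) ω - x (t + 1))) ∂μ
        = ∫⁻ ω, ballMGF (s • (F t (X t ω) - F t (x t)) + s • w t ω) ∂μ := by
          refine lintegral_congr fun ω => ?_
          rw [hX_succ, hx_succ, ← smul_add]
          congr 2
          abel
      _ ≤ _ := hstep
      _ ≤ ENNReal.ofReal (Real.exp (s ^ 2 * σ t ^ 2 / 2)) *
          (ENNReal.ofReal (Real.exp ((s * L t) ^ 2 * Psi L σ t / 2)) *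
            volume (Metric.closedBall (0 : EuclideanSpace ℝ (Fin n)) 1)) := by
          gcongr
          exact (lintegral_mono hcontr).trans (ih _)
      _ = _ := by
          rw [← mul_assoc, ← ENNReal.ofReal_mul (Real.exp_nonneg _), ← Real.exp_add, Psi_succ]
          congr 3
          ring

theorem theorem1 {n p : ℕ} {Ω : Type*} [MeasurableSpace Ω] (μ : Measure Ω)
    [IsProbabilityMeasure μ]
    (f : EuclideanSpace ℝ (Fin n) → EuclideanSpace ℝ (Fin p) → ℕ → EuclideanSpace ℝ (Fin n))
    (L : ℕ → ℝ) (hL : ∀ t, 0 ≤ L t)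
    (hf : ∀ (t : ℕ) (x y : EuclideanSpace ℝ (Fin n)) (u : EuclideanSpace ℝ (Fin p)),
      ‖f x u t - f y u t‖ ≤ L t * ‖x - y‖)
    (σ : ℕ → ℝ) (hσ : ∀ t, 0 ≤ σ t)
    (w : ℕ → Ω → EuclideanSpace ℝ (Fin n))
    (hw_meas : ∀ t, Measurable (w t))
    (hw_indep : iIndepFun w μ)
    (hw_subG : ∀ t, IsSubG (w t) (σ t ^ 2) μ)
    (u : ℕ → EuclideanSpace ℝ (Fin p))
    (x₀ : EuclideanSpace ℝ (Fin n))
    (X : ℕ → Ω → EuclideanSpace ℝ (Fin n))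
    (hX_zero : ∀ ω, X 0 ω = x₀)
    (hX_succ : ∀ t ω, X (t + 1) ω = f (X t ω) (u t) t + w t ω)
    (x : ℕ → EuclideanSpace ℝ (Fin n))
    (hx_zero : x 0 = x₀)
    (hx_succ : ∀ t, x (t + 1) = f (x t) (u t) t)
    (t : ℕ) (δ : ℝ) (hδ : δ ∈ Set.Ioo (0 : ℝ) 1) (ε : ℝ) (hε : ε ∈ Set.Ioo (0 : ℝ) 1) :
    1 - δ ≤ μ.real {ω | ‖X t ω - x t‖ ≤
      √(Psi L σ t * (eps1 ε * n + eps2 ε * Real.log (1 / δ)))} := by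
  have hF_meas : ∀ t, Measurable fun y => f y (u t) t := fun t =>
    (LipschitzWith.of_dist_le_mul (K := ⟨L t, hL t⟩) fun a b => by
      rw [dist_eq_norm, dist_eq_norm]
      exact hf t a b (u t)).continuous.measurable
  have hX_meas : ∀ t, Measurable (X t) := by
    intro t
    induction t with
    | zero => exact (funext hX_zero : X 0 = fun _ => x₀) ▸ measurable_const
    | succ t ih =>
      rw [show X (t + 1) = _ from funext (hX_succ t)]
      exact ((hF_meas t).comp ih).add (hw_meas t)
  have hXw : ∀ t, IndepFun (X t) (w t) μ :=
    indepFun_state_noise (F := fun t y a => f y (u t) t + a)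
      (fun t => ((hF_meas t).comp measurable_fst).add measurable_snd) hw_meas hw_indep hX_zero
      hX_succ
  have hmgf := lintegral_ballMGF_deviation_le (F := fun t y => f y (u t) t)
    (fun t a b => hf t a b (u t)) hw_meas hw_subG hF_meas hX_meas hXw
    (fun ω => (hX_zero ω).trans hx_zero.symm) hX_succ hx_succ t
  obtain ⟨hδ₀, hδ₁⟩ := hδ
  obtain ⟨hε₀, hε₁⟩ := hε
  have hε' : 0 < 1 - ε := sub_pos.2 hε₁
  set B := volume (Metric.closedBall (0 : EuclideanSpace ℝ (Fin n)) 1)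
  have hB₀ : B ≠ 0 := (Metric.measure_closedBall_pos volume _ one_pos).ne'
  have hB₁ : B ≠ ⊤ := measure_closedBall_lt_top.ne
  have hdev : Measurable fun ω => X t ω - x t := (hX_meas t).sub_const _
  have hY : Measurable fun ω => (1 - ε) * ‖X t ω - x t‖ := hdev.norm.const_mul _
  have hK₁ : 1 ≤ (1 + 2 / ε) ^ n := one_le_pow₀ (by have := div_pos two_pos hε₀; linarith)
  have hexp : ∀ s, 0 ≤ s → ∫⁻ ω, ENNReal.ofReal (Real.exp (s * ((1 - ε) * ‖X t ω - x t‖))) ∂μ ≤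
      ENNReal.ofReal ((1 + 2 / ε) ^ n * Real.exp (s ^ 2 * Psi L σ t / 2)) := by
    intro s hs
    set c := ENNReal.ofReal ((ε / 2) ^ n) with hc
    have hlow : c * B * ∫⁻ ω, ENNReal.ofReal (Real.exp (s * ((1 - ε) * ‖X t ω - x t‖))) ∂μ ≤
        ENNReal.ofReal (Real.exp (s ^ 2 * Psi L σ t / 2)) * B := by
      rw [← lintegral_const_mul _ (by fun_prop)]
      refine (lintegral_mono fun ω => ?_).trans (hmgf s)
      have h := le_ballMGF (s • (X t ω - x t)) hε₀.le hε₁.le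
      rwa [finrank_euclideanSpace_fin, norm_smul, Real.norm_of_nonneg hs, mul_left_comm] at h
    have hle : c * ∫⁻ ω, ENNReal.ofReal (Real.exp (s * ((1 - ε) * ‖X t ω - x t‖))) ∂μ ≤
        ENNReal.ofReal (Real.exp (s ^ 2 * Psi L σ t / 2)) := by
      rw [mul_right_comm] at hlow
      exact (ENNReal.mul_le_mul_iff_left hB₀ hB₁).1 hlow
    have hc₁ : ENNReal.ofReal ((2 / ε) ^ n) * c = 1 := by
      rw [hc, ← ENNReal.ofReal_mul (by positivity), ← mul_pow, div_mul_div_cancel₀ hε₀.ne',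
        div_self two_ne_zero, one_pow, ENNReal.ofReal_one]
    calc ∫⁻ ω, ENNReal.ofReal (Real.exp (s * ((1 - ε) * ‖X t ω - x t‖))) ∂μ
        = ENNReal.ofReal ((2 / ε) ^ n) *
          (c * ∫⁻ ω, ENNReal.ofReal (Real.exp (s * ((1 - ε) * ‖X t ω - x t‖))) ∂μ) := by
          rw [← mul_assoc, hc₁, one_mul]
      _ ≤ ENNReal.ofReal ((2 / ε) ^ n) *
          ENNReal.ofReal (Real.exp (s ^ 2 * Psi L σ t / 2)) := by gcongr
      -- Here 2/ε is weakened to 1 + 2/ε, the constant in `eps1`.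
      _ ≤ _ := by
          rw [← ENNReal.ofReal_mul (by positivity)]
          gcongr
          linarith
  have htail := measure_lt_le_of_lintegral_exp_le hY (one_pos.trans_le hK₁) (Psi_nonneg L σ t)
    hexp hδ₀ (hδ₁.le.trans hK₁)
  -- Undoing the factor 1 - ε in front of the norm produces the denominators (1 - ε)² of `eps1` and
  -- `eps2`.
  have hradius : √(2 * Psi L σ t * Real.log ((1 + 2 / ε) ^ n / δ)) =
      (1 - ε) * √(Psi L σ t * (eps1 ε * n + eps2 ε * Real.log (1 / δ))) := by
    rw [← Real.sqrt_sq hε'.le, ← Real.sqrt_mul (sq_nonneg _), eps1, eps2,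
      Real.log_div (by positivity) hδ₀.ne', Real.log_pow, one_div, Real.log_inv]
    congr 1
    field_simp
    ring
  set R := √(Psi L σ t * (eps1 ε * n + eps2 ε * Real.log (1 / δ)))
  have hcompl : {ω | √(2 * Psi L σ t * Real.log ((1 + 2 / ε) ^ n / δ)) <
      (1 - ε) * ‖X t ω - x t‖} = {ω | ‖X t ω - x t‖ ≤ R}ᶜ := by
    ext ω
    simp only [hradius, Set.mem_ofPred_eq, Set.mem_compl_iff, not_le]
    exact mul_lt_mul_iff_right₀ hε'
  rw [hcompl] at htail
  have hreal : μ.real {ω | ‖X t ω - x t‖ ≤ R}ᶜ ≤ δ := ENNReal.toReal_le_of_le_ofReal hδ₀.le htail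
  rw [probReal_compl_eq_one_sub (measurableSet_le hdev.norm measurable_const)] at hreal
  linarith
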